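/- For every integer $\ell\ge 1$ there is a constant $C>0$, depending only on $\ell$, such that the following holds. Let $p$ be an odd prime and let $K,L,M,N$ be integers with $0\le K<K+M<p$, $0\le L<L+N<p$ and $N^2\ge M\ge N^{1/2}$. Let $F_\ell(K,M;L,N)$ denote the number of solutions $(m_1,\ldots,m_{2\ell},n_1,\ldots,n_{2\ell})$ in integers of the congruence $$\sum_{i=1}^{\ell}n_i!\,m_i!\equiv\sum_{i=\ell+1}^{2\ell}n_i!\,m_i!\pmod p,$$ with $K+1\le m_1,\ldots,m_{2\ell}\le K+M$ and $L+1\le n_1,\ldots,n_{2\ell}\le L+N$. Then $$F_\ell(K,M;L,N)\le C\,M^{2\ell-1+\frac{1}{2\ell}}\,N^{2\ell-\frac{1}{2(\ell+1)}}.$$ -/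

import Mathlib

open scoped Nat

/-- The finite set of solutions `(m, n)` of the congruence
`∑_{i ≤ ℓ} nᵢ! mᵢ! ≡ ∑_{ℓ < i ≤ 2ℓ} nᵢ! mᵢ! (mod p)` with
`K + 1 ≤ m₁, …, m_{2ℓ} ≤ K + M` and `L + 1 ≤ n₁, …, n_{2ℓ} ≤ L + N`.
The indices `1, …, 2ℓ` are represented by `0, …, 2ℓ - 1` in `Fin (2 * ℓ)`. -/
def doubleFactorialSolutions (p ℓ K M L N : ℕ) :
    Finset ((Fin (2 * ℓ) → ℕ) × (Fin (2 * ℓ) → ℕ)) :=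
  ((Fintype.piFinset fun _ : Fin (2 * ℓ) => Finset.Icc (K + 1) (K + M)) ×ˢ
      (Fintype.piFinset fun _ : Fin (2 * ℓ) => Finset.Icc (L + 1) (L + N))).filter
    fun x =>
      (∑ i : Fin (2 * ℓ) with i.val < ℓ, (x.2 i)! * (x.1 i)!) ≡
        (∑ i : Fin (2 * ℓ) with ℓ ≤ i.val, (x.2 i)! * (x.1 i)!) [MOD p]

/-- `F_ℓ(K, M; L, N)`: the number of solutions of the congruence above. -/
def doubleFactorialCount (p ℓ K M L N : ℕ) : ℕ :=
  (doubleFactorialSolutions p ℓ K M L N).card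

/-!
The number of solutions of a balanced congruence is an even moment of an exponential sum
(`card_balanced_mul`), so `F_ℓ` is `p⁻¹` times the `2ℓ`-th moment of
`S(a) = ∑_{m, n} e(a m! n! / p)`.

Every `m` is written in `I` ways as `m = b - j` with `0 ≤ j < I`. Hölder's inequality over `b`
bounds the moment of `S` by an average of moments of sums in which the factorials all lie in one
window below `b`, that is, by the number of `b` and of tuples `(j_s, w_s)` with
`∑_s ± (b - j_s)! g(w_s) = 0`, where `g` carries the second factor. Dividing by `(b - I)!` turns
this equation into a polynomial one in `b - I + 1`, whose coefficients in the basis of rising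
factorials are the sums of `± g(w_s)` over the `s` with a prescribed `j_s`. If these do not all
vanish there are at most `I` roots `b`; otherwise the tuple is degenerate, and every `b` may
occur. This gives `moment_factorialMul_le`.

Degenerate tuples are rare (`degenerateCount_mul_le`). As `g` has no zeros, no value is taken by
exactly one `j_s`, so at most `ℓ` values occur, and for each value the condition on the
corresponding `w_s` saves at least what the congruence `g(w) = g(w')` saves. If all `j_s` agree,
the condition is the original congruence for `g`, which saves more.

With `g = 1` on a one-point set, `I ≈ M ^ (1 / (ℓ + 1))` yields the bound
`M ^ (2ℓ - 1 + 1 / (ℓ + 1))` for the number of solutions with one factorial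
(`exists_moment_factorial_le`). Its cases `ℓ` and `1` are then used for `g(n) = n!`, with
`I ≈ M ^ (1 / (2ℓ)) N ^ (-1 / (2 (ℓ + 1)))`, which balances the nondegenerate tuples against
the degenerate ones with all `j_s` equal and gives `exists_moment_factorial_mul_factorial_le` for
`N ≤ M ≤ N ^ 2`. For `M < N` the same is done with the roles of `m` and `n` exchanged, where the
bound obtained is stronger than the one claimed.
-/

/-! ### Exponential sums and counting -/

/-- The exponential sum `∑_{x ∈ A} e(a f(x) / p)`. -/
noncomputable def expSum {p : ℕ} [NeZero p] {α : Type*} (A : Finset α) (f : α → ZMod p)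
    (a : ZMod p) : ℂ :=
  ∑ x ∈ A, ZMod.stdAddChar (a * f x)

/-- The sign of the index `s` in a balanced congruence in `2ℓ` variables: `1` on the left hand
side, `-1` on the right hand side. -/
def sideSign (p ℓ : ℕ) (s : Fin (2 * ℓ)) : ZMod p := if s.val < ℓ then 1 else -1

lemma sideSign_eq (p ℓ : ℕ) (s : Fin (2 * ℓ)) : sideSign p ℓ s = 1 ∨ sideSign p ℓ s = -1 := by
  unfold sideSign; split_ifs <;> simp

section

variable {p : ℕ} [Fact p.Prime] {α : Type*}

lemma norm_expSum_le (A : Finset α) (f : α → ZMod p) (a : ZMod p) :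
    ‖expSum A f a‖ ≤ A.card := by
  unfold expSum
  refine (norm_sum_le _ _).trans ?_
  simp [AddChar.norm_apply]

lemma expSum_neg (A : Finset α) (f : α → ZMod p) (a : ZMod p) :
    expSum A f (-a) = (starRingEnd ℂ) (expSum A f a) := by
  unfold expSum
  rw [map_sum]
  refine Finset.sum_congr rfl fun x _ => ?_
  rw [neg_mul, AddChar.map_neg_eq_conj]

/-- Orthogonality of characters detects the solutions of a linear equation. -/
lemma card_solutions_mul {ι : Type*} [Fintype ι] [DecidableEq ι] (A : Finset α) (f : α → ZMod p)
    (ε : ι → ZMod p) :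
    (((Fintype.piFinset fun _ : ι => A).filter fun x => ∑ s, ε s * f (x s) = 0).card : ℂ) * p =
      ∑ a : ZMod p, ∏ s, expSum A f (ε s * a) := by
  have h1 : ∀ a : ZMod p, ∏ s, expSum A f (ε s * a) =
      ∑ x ∈ Fintype.piFinset fun _ : ι => A,
        ZMod.stdAddChar (a * ∑ s, ε s * f (x s)) := by
    intro a
    unfold expSum
    rw [Finset.prod_univ_sum]
    refine Finset.sum_congr rfl fun x _ => ?_
    rw [Finset.mul_sum]
    have : (ZMod.stdAddChar (∑ s, a * (ε s * f (x s))) : ℂ) =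
        ∏ s, ZMod.stdAddChar (a * (ε s * f (x s))) := by
      exact map_prod (ZMod.stdAddChar (N := p)).toMonoidHom
        (fun s => Multiplicative.ofAdd (a * (ε s * f (x s)))) Finset.univ
    rw [this]
    refine Finset.prod_congr rfl fun s _ => ?_
    congr 1; ring
  simp_rw [h1]
  rw [Finset.sum_comm]
  simp_rw [AddChar.sum_mulShift _ (ZMod.isPrimitive_stdAddChar p), ZMod.card]
  rw [Finset.card_filter]
  push_cast
  rw [Finset.sum_mul]
  refine Finset.sum_congr rfl fun x _ => ?_
  split_ifs <;> simp

/-- The even moment of an exponential sum counts the solutions of a balanced congruence. -/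
lemma card_balanced_mul (ℓ : ℕ) (A : Finset α) (f : α → ZMod p) :
    (((Fintype.piFinset fun _ : Fin (2 * ℓ) => A).filter
        fun x => ∑ s, sideSign p ℓ s * f (x s) = 0).card : ℝ) * p =
      ∑ a : ZMod p, ‖expSum A f a‖ ^ (2 * ℓ) := by
  have h := card_solutions_mul A f (sideSign p ℓ)
  have h2 : ∀ a : ZMod p, ∏ s, expSum A f (sideSign p ℓ s * a) =
      ((‖expSum A f a‖ ^ (2 * ℓ) : ℝ) : ℂ) := by
    intro a
    have : ∀ s : Fin (2 * ℓ), expSum A f (sideSign p ℓ s * a) =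
        if s.val < ℓ then expSum A f a else (starRingEnd ℂ) (expSum A f a) := by
      intro s
      unfold sideSign
      split_ifs
      · rw [one_mul]
      · rw [neg_one_mul, expSum_neg]
    simp_rw [this]
    rw [Fin.prod_univ_eq_prod_range (fun i => if i < ℓ then expSum A f a else
      (starRingEnd ℂ) (expSum A f a)) (2 * ℓ), two_mul, Finset.prod_range_add]
    rw [Finset.prod_congr rfl (g := fun _ => expSum A f a)
      (fun x hx => by simp [Finset.mem_range.1 hx])]
    rw [Finset.prod_congr rfl (s₁ := Finset.range ℓ) (f := fun x => if ℓ + x < ℓ then _ else _)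
      (g := fun _ => (starRingEnd ℂ) (expSum A f a)) (fun x hx => by simp)]
    simp only [Finset.prod_const, Finset.card_range]
    rw [← mul_pow, Complex.mul_conj, Complex.normSq_eq_norm_sq, ← two_mul, pow_mul]
    push_cast; ring
  simp_rw [h2] at h
  exact_mod_cast h

/-- With arbitrary signs the number of solutions is at most the corresponding moment. -/
lemma card_signed_mul_le {ι : Type*} [Fintype ι] [DecidableEq ι] (A : Finset α) (f : α → ZMod p)
    (ε : ι → ZMod p) (hε : ∀ s, ε s = 1 ∨ ε s = -1) :
    (((Fintype.piFinset fun _ : ι => A).filter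
        fun x => ∑ s, ε s * f (x s) = 0).card : ℝ) * p ≤
      ∑ a : ZMod p, ‖expSum A f a‖ ^ (Fintype.card ι) := by
  have h := congrArg norm (card_solutions_mul A f ε)
  rw [norm_mul, Complex.norm_natCast, Complex.norm_natCast] at h
  rw [h]
  refine (norm_sum_le _ _).trans (Finset.sum_le_sum fun a _ => le_of_eq ?_)
  rw [norm_prod, Fintype.card, ← Finset.prod_const]
  refine Finset.prod_congr rfl fun s _ => ?_
  rcases hε s with h | h <;> rw [h]
  · rw [one_mul]
  · rw [neg_one_mul, expSum_neg, RCLike.norm_conj]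

/-- A signed equation in `ι` has at most `|A| ^ (|ι| - 2)` times as many solutions as
`f x = f y`. -/
lemma card_signed_le {ι : Type*} [Fintype ι] [DecidableEq ι] (A : Finset α) (f : α → ZMod p)
    (ε : ι → ZMod p) (hε : ∀ s, ε s = 1 ∨ ε s = -1) (hι : 2 ≤ Fintype.card ι) :
    (((Fintype.piFinset fun _ : ι => A).filter
        fun x => ∑ s, ε s * f (x s) = 0).card : ℝ) * p ≤
      (A.card : ℝ) ^ (Fintype.card ι - 2) * ∑ a : ZMod p, ‖expSum A f a‖ ^ 2 := by
  refine (card_signed_mul_le A f ε hε).trans ?_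
  rw [Finset.mul_sum]
  refine Finset.sum_le_sum fun a _ => ?_
  conv_lhs => rw [← Nat.sub_add_cancel hι, pow_add]
  gcongr
  exact norm_expSum_le A f a

end

/-! ### Degenerate systems -/

/-- The maps `w : ι → β` whose restriction to each fibre of `j` satisfies a given condition are
counted by a product over the fibres. -/
lemma card_forall_fiber {ι κ β : Type*} [Fintype ι] [DecidableEq ι] [Fintype κ] [DecidableEq κ]
    [Fintype β] (j : ι → κ) (P : ∀ v, ({s // j s = v} → β) → Prop) [∀ v, DecidablePred (P v)] :
    (Finset.univ.filter fun w : ι → β => ∀ v, P v fun s => w s).card =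
      ∏ v, (Finset.univ.filter fun u : {s // j s = v} → β => P v u).card := by
  let e : (ι → β) ≃ (∀ v, {s // j s = v} → β) :=
    { toFun := fun w v s => w s
      invFun := fun u s => u (j s) ⟨s, rfl⟩
      left_inv := fun w => rfl
      right_inv := fun u => by
        funext v s
        obtain ⟨s, rfl⟩ := s
        rfl }
  have e2 : {w : ι → β // ∀ v, P v fun s => w s} ≃ ∀ v, {u : {s // j s = v} → β // P v u} :=
    (e.subtypeEquiv (q := fun u => ∀ v, P v (u v)) fun w => Iff.rfl).trans Equiv.subtypePiEquivPi
  rw [← Fintype.card_subtype, Fintype.card_congr e2, Fintype.card_pi]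
  exact Finset.prod_congr rfl fun v _ => Fintype.card_subtype _

lemma card_filter_card_image_le (ι : Type*) [Fintype ι] [DecidableEq ι] (I r : ℕ) :
    (Finset.univ.filter fun j : ι → Fin I => (Finset.univ.image j).card = r).card ≤
      I ^ r * r ^ Fintype.card ι := by
  have hsub : (Finset.univ.filter fun j : ι → Fin I => (Finset.univ.image j).card = r) ⊆
      (Finset.powersetCard r (Finset.univ : Finset (Fin I))).biUnion
        fun T => Fintype.piFinset fun _ : ι => T := by
    intro j hj
    rw [Finset.mem_filter] at hj
    rw [Finset.mem_biUnion]
    exact ⟨Finset.univ.image j, Finset.mem_powersetCard.2 ⟨Finset.subset_univ _, hj.2⟩,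
      Fintype.mem_piFinset.2 fun s => Finset.mem_image_of_mem _ (Finset.mem_univ s)⟩
  refine (Finset.card_le_card hsub).trans ((Finset.card_biUnion_le_card_mul _ _
    (r ^ Fintype.card ι) ?_).trans ?_)
  · intro T hT
    rw [Fintype.card_piFinset, Finset.prod_const, (Finset.mem_powersetCard.1 hT).2,
      Finset.card_univ]
  · rw [Finset.card_powersetCard, Finset.card_univ, Fintype.card_fin]
    exact Nat.mul_le_mul_right _ (Nat.choose_le_pow I r)

section

variable {p : ℕ} [Fact p.Prime] {β : Type*} [Fintype β]

/-- The number of families of pairs `(j_s, w_s)`, `s < 2ℓ`, such that for every `v` the signed sum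
of the `g (w_s)` over the `s` with `j_s = v` vanishes. These are the families for which
`∑ ± g (w_s) X_{j_s}` vanishes as a linear form. -/
def degenerateCount (ℓ I : ℕ) (g : β → ZMod p) : ℕ :=
  (Finset.univ.filter fun x : Fin (2 * ℓ) → Fin I × β =>
    ∀ v, ∑ s with (x s).1 = v, sideSign p ℓ s * g (x s).2 = 0).card

/-- The families counted by `degenerateCount` with prescribed first components `j`. -/
def degenerateFiber {ℓ I : ℕ} (g : β → ZMod p) (j : Fin (2 * ℓ) → Fin I) :
    Finset (Fin (2 * ℓ) → β) :=
  Finset.univ.filter fun w => ∀ v, ∑ s with j s = v, sideSign p ℓ s * g (w s) = 0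

lemma degenerateCount_eq_sum (ℓ I : ℕ) (g : β → ZMod p) :
    degenerateCount ℓ I g = ∑ j : Fin (2 * ℓ) → Fin I, (degenerateFiber g j).card := by
  unfold degenerateCount degenerateFiber
  simp_rw [Finset.card_filter]
  rw [← Fintype.sum_prod_type']
  exact Fintype.sum_equiv (Equiv.arrowProdEquivProdArrow _ _ _) _ _ fun x => rfl

lemma card_degenerateFiber_eq_prod {ℓ I : ℕ} (g : β → ZMod p) (j : Fin (2 * ℓ) → Fin I) :
    (degenerateFiber g j).card = ∏ v, (Finset.univ.filter fun u : {s // j s = v} → β =>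
      ∑ s : {s // j s = v}, sideSign p ℓ s * g (u s) = 0).card := by
  refine Eq.trans (congrArg Finset.card ?_)
    (card_forall_fiber j fun v u => ∑ s : {s // j s = v}, sideSign p ℓ s * g (u s) = 0)
  ext w
  simp only [degenerateFiber, Finset.mem_filter, Finset.mem_univ, true_and]
  refine forall_congr' fun v => ?_
  rw [← Finset.sum_subtype (Finset.univ.filter fun s => j s = v) (by simp)
    fun s => sideSign p ℓ s * g (w s)]

lemma card_degenerateFiber_mul_le_moment {ℓ I : ℕ} (g : β → ZMod p) (j : Fin (2 * ℓ) → Fin I) :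
    ((degenerateFiber g j).card : ℝ) * p ≤
      ∑ a : ZMod p, ‖expSum Finset.univ g a‖ ^ (2 * ℓ) := by
  rw [← card_balanced_mul]
  gcongr
  intro w hw
  rw [degenerateFiber, Finset.mem_filter] at hw
  rw [Finset.mem_filter]
  refine ⟨by simp, ?_⟩
  rw [← Finset.sum_fiberwise Finset.univ j]
  exact Finset.sum_eq_zero fun v _ => hw.2 v

/-- No fibre of `j` can be a singleton, since `g` does not vanish. -/
lemma card_image_le_of_degenerateFiber {ℓ I : ℕ} {g : β → ZMod p} (hg : ∀ w, g w ≠ 0)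
    {j : Fin (2 * ℓ) → Fin I} {w : Fin (2 * ℓ) → β} (hw : w ∈ degenerateFiber g j) :
    (∀ v ∈ Finset.univ.image j, 2 ≤ Fintype.card {s // j s = v}) ∧
      (Finset.univ.image j).card ≤ ℓ := by
  have key : ∀ v ∈ Finset.univ.image j, 2 ≤ (Finset.univ.filter fun s => j s = v).card := by
    intro v hv
    rw [degenerateFiber, Finset.mem_filter] at hw
    by_contra! hlt
    obtain ⟨s, -, hs⟩ := Finset.mem_image.1 hv
    have hmem : s ∈ Finset.univ.filter fun s => j s = v := by simp [hs]
    have h1 : (Finset.univ.filter fun s => j s = v).card = 1 := by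
      have := Finset.card_pos.2 ⟨s, hmem⟩
      omega
    obtain ⟨t, ht⟩ := Finset.card_eq_one.1 h1
    have h2 := hw.2 v
    rw [ht, Finset.sum_singleton] at h2
    rcases mul_eq_zero.1 h2 with h | h
    · rcases sideSign_eq p ℓ t with h' | h' <;> simp [h'] at h
    · exact hg _ h
  refine ⟨fun v hv => by rw [Fintype.card_subtype]; exact key v hv, ?_⟩
  have := Finset.card_nsmul_le_sum (Finset.univ.image j)
    (fun v => (Finset.univ.filter fun s => j s = v).card) 2 key
  rw [← Finset.card_eq_sum_card_image, Finset.card_univ, Fintype.card_fin, smul_eq_mul] at this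
  omega

/-- If `θ |β|²` bounds the number of solutions of `g x = g y`, each value taken by `j` saves
a factor `θ`. -/
lemma card_degenerateFiber_le {ℓ I : ℕ} {g : β → ZMod p} (hg : ∀ w, g w ≠ 0) {θ : ℝ}
    (hθ : ∑ a : ZMod p, ‖expSum Finset.univ g a‖ ^ 2 ≤ θ * (Fintype.card β : ℝ) ^ 2 * p)
    (j : Fin (2 * ℓ) → Fin I) (hne : (degenerateFiber g j).Nonempty) :
    ((degenerateFiber g j).card : ℝ) ≤
      (Fintype.card β : ℝ) ^ (2 * ℓ) * θ ^ (Finset.univ.image j).card := by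
  have hp : (0 : ℝ) < p := by exact_mod_cast (Fact.out : p.Prime).pos
  obtain ⟨w, hw⟩ := hne
  have h2 := (card_image_le_of_degenerateFiber hg hw).1
  rw [card_degenerateFiber_eq_prod]
  push_cast
  have hb : ∀ v, ((Finset.univ.filter fun u : {s // j s = v} → β =>
      ∑ s : {s // j s = v}, sideSign p ℓ s * g (u s) = 0).card : ℝ) ≤
      (Fintype.card β : ℝ) ^ Fintype.card {s // j s = v} *
        if v ∈ Finset.univ.image j then θ else 1 := by
    intro v
    split_ifs with hv
    · have h := card_signed_le Finset.univ g (fun s : {s // j s = v} => sideSign p ℓ s)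
        (fun s => sideSign_eq p ℓ s) (h2 v hv)
      rw [Fintype.piFinset_univ, Finset.card_univ] at h
      refine le_of_mul_le_mul_right (h.trans ((mul_le_mul_of_nonneg_left hθ (by positivity)).trans
        (le_of_eq ?_))) hp
      conv_rhs => rw [← Nat.sub_add_cancel (h2 v hv), pow_add]
      ring
    · rw [mul_one]
      have : (Finset.univ.filter fun u : {s // j s = v} → β =>
          ∑ s : {s // j s = v}, sideSign p ℓ s * g (u s) = 0).card ≤ _ := Finset.card_filter_le _ _
      rw [Finset.card_univ, Fintype.card_fun] at this
      exact_mod_cast this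
  refine (Finset.prod_le_prod (fun v _ => by positivity) fun v _ => hb v).trans (le_of_eq ?_)
  rw [Finset.prod_mul_distrib, Finset.prod_pow_eq_pow_sum, ← Fintype.card_sigma,
    Fintype.card_congr (Equiv.sigmaFiberEquiv j), Fintype.card_fin, Finset.prod_ite,
    Finset.prod_const_one, mul_one, Finset.prod_const, Finset.filter_mem_eq_inter,
    Finset.univ_inter]

/-- The families with all `j_s` equal are counted by the `2ℓ`-th moment; the others save a factor
`θ` for each of the `r` values among the `j_s`. -/
lemma degenerateCount_mul_le {ℓ : ℕ} (hℓ : 1 ≤ ℓ) (I : ℕ) {g : β → ZMod p} (hg : ∀ w, g w ≠ 0)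
    {θ : ℝ} (hθ0 : 0 ≤ θ)
    (hθ : ∑ a : ZMod p, ‖expSum Finset.univ g a‖ ^ 2 ≤ θ * (Fintype.card β : ℝ) ^ 2 * p) :
    (degenerateCount ℓ I g : ℝ) * p ≤
      (ℓ : ℝ) ^ (2 * ℓ) * (I * ∑ a : ZMod p, ‖expSum Finset.univ g a‖ ^ (2 * ℓ) +
        (Fintype.card β : ℝ) ^ (2 * ℓ) * p * ∑ r ∈ Finset.Icc 2 ℓ, (I * θ) ^ r) := by
  set E := ∑ a : ZMod p, ‖expSum Finset.univ g a‖ ^ (2 * ℓ)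
  have hE0 : 0 ≤ E := Finset.sum_nonneg fun a _ => by positivity
  set b : ℕ → ℝ := fun r => if r = 1 then E else
    (Fintype.card β : ℝ) ^ (2 * ℓ) * p * θ ^ r with hb
  have hb0 : ∀ r, 0 ≤ b r := fun r => by
    simp only [hb]; split_ifs <;> positivity
  have h1 : ∀ j : Fin (2 * ℓ) → Fin I, ((degenerateFiber g j).card : ℝ) * p ≤
      ∑ r ∈ Finset.Icc 1 ℓ, if (Finset.univ.image j).card = r then b r else 0 := by
    intro j
    rcases (degenerateFiber g j).eq_empty_or_nonempty with he | hne
    · rw [he, Finset.card_empty, Nat.cast_zero, zero_mul]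
      exact Finset.sum_nonneg fun r _ => by split_ifs; exacts [hb0 r, le_rfl]
    have hle := (card_image_le_of_degenerateFiber hg hne.choose_spec).2
    have hpos : 1 ≤ (Finset.univ.image j).card :=
      Finset.card_pos.2 ⟨j ⟨0, by omega⟩, Finset.mem_image_of_mem _ (Finset.mem_univ _)⟩
    rw [Finset.sum_ite_eq, if_pos (Finset.mem_Icc.2 ⟨hpos, hle⟩)]
    simp only [hb]
    split_ifs
    · exact card_degenerateFiber_mul_le_moment g j
    · have := card_degenerateFiber_le hg hθ j hne
      calc _ ≤ _ := mul_le_mul_of_nonneg_right this (Nat.cast_nonneg p)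
        _ = _ := by ring
  have h2 : ∀ r ∈ Finset.Icc 1 ℓ, ∑ j : Fin (2 * ℓ) → Fin I,
      (if (Finset.univ.image j).card = r then b r else 0) ≤
      (ℓ : ℝ) ^ (2 * ℓ) * ((I : ℝ) ^ r * b r) := by
    intro r hr
    rw [← Finset.sum_filter, Finset.sum_const, nsmul_eq_mul, ← mul_assoc]
    refine mul_le_mul_of_nonneg_right ?_ (hb0 r)
    have h := card_filter_card_image_le (Fin (2 * ℓ)) I r
    rw [Fintype.card_fin] at h
    have h' : I ^ r * r ^ (2 * ℓ) ≤ ℓ ^ (2 * ℓ) * I ^ r := by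
      rw [mul_comm]
      exact Nat.mul_le_mul_right _ (Nat.pow_le_pow_left (Finset.mem_Icc.1 hr).2 _)
    exact_mod_cast h.trans h'
  rw [degenerateCount_eq_sum]
  push_cast
  rw [Finset.sum_mul]
  refine (Finset.sum_le_sum fun j _ => h1 j).trans ?_
  rw [Finset.sum_comm]
  refine (Finset.sum_le_sum h2).trans (le_of_eq ?_)
  rw [← Finset.mul_sum]
  congr 1
  have hI : Finset.Icc 1 ℓ = insert 1 (Finset.Icc 2 ℓ) := by
    ext r; simp only [Finset.mem_insert, Finset.mem_Icc]; omega
  rw [hI, Finset.sum_insert (by simp)]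
  congr 1
  · simp [hb]
  · rw [Finset.mul_sum]
    refine Finset.sum_congr rfl fun r hr => ?_
    have : r ≠ 1 := by have := (Finset.mem_Icc.1 hr).1; omega
    simp only [hb, if_neg this]
    ring

end

/-! ### Shifting the argument of a factorial -/

/-- The rising factorials `X (X + 1) ⋯ (X + n - 1)`, one polynomial in each degree. -/
noncomputable def ascPochhammerSequence (R : Type*) [CommRing R] [IsDomain R] :
    Polynomial.Sequence R where
  elems' n := ascPochhammer R n
  degree_eq' n := by
    rw [Polynomial.degree_eq_natDegree (monic_ascPochhammer R n).ne_zero, ascPochhammer_natDegree]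

section

variable {p : ℕ} [Fact p.Prime] {β : Type*}

/-- The summand `m! g(w)`, read modulo `p`. -/
def factorialMul (g : β → ZMod p) (x : ℕ × β) : ZMod p := (x.1)! * g x.2

/-- The polynomial `∑_s ± g(w_s) X (X + 1) ⋯ (X + I - j_s - 1)`. -/
noncomputable def shiftPoly {ℓ I : ℕ} (g : β → ZMod p) (x : Fin (2 * ℓ) → Fin I × β) :
    Polynomial (ZMod p) :=
  ∑ s, Polynomial.C (sideSign p ℓ s * g (x s).2) * ascPochhammer (ZMod p) (I - (x s).1)

lemma natDegree_shiftPoly_le {ℓ I : ℕ} (g : β → ZMod p) (x : Fin (2 * ℓ) → Fin I × β) :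
    (shiftPoly g x).natDegree ≤ I := by
  refine Polynomial.natDegree_sum_le_of_forall_le _ _ fun s _ => ?_
  refine (Polynomial.natDegree_C_mul_le _ _).trans ?_
  rw [ascPochhammer_natDegree]
  exact Nat.sub_le _ _

/-- Rising factorials of distinct lengths are linearly independent. -/
lemma sum_eq_zero_of_shiftPoly_eq_zero {ℓ I : ℕ} (g : β → ZMod p) (x : Fin (2 * ℓ) → Fin I × β)
    (h : shiftPoly g x = 0) (v : Fin I) :
    ∑ s with (x s).1 = v, sideSign p ℓ s * g (x s).2 = 0 := by
  have hli : LinearIndependent (ZMod p) fun v : Fin I => ascPochhammer (ZMod p) (I - v) := by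
    refine (ascPochhammerSequence (ZMod p)).linearIndependent.comp (fun v : Fin I => I - (v : ℕ)) ?_
    intro u v huv
    have := u.isLt
    have := v.isLt
    ext
    simp only at huv
    omega
  refine Fintype.linearIndependent_iff.1 hli
    (fun v => ∑ s with (x s).1 = v, sideSign p ℓ s * g (x s).2) ?_ v
  rw [← h, shiftPoly, ← Finset.sum_fiberwise Finset.univ fun s => (x s).1]
  refine Finset.sum_congr rfl fun v _ => ?_
  rw [Finset.sum_smul]
  refine Finset.sum_congr rfl fun s hs => ?_
  rw [(Finset.mem_filter.1 hs).2, Polynomial.smul_eq_C_mul]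

lemma sum_factorialMul_eq_eval {ℓ I : ℕ} (g : β → ZMod p) (x : Fin (2 * ℓ) → Fin I × β) {b : ℕ}
    (hb : I ≤ b) :
    ∑ s, sideSign p ℓ s * factorialMul g (b - (x s).1, (x s).2) =
      ((b - I)! : ZMod p) * (shiftPoly g x).eval ((b - I + 1 : ℕ) : ZMod p) := by
  rw [shiftPoly, Polynomial.eval_finsetSum, Finset.mul_sum]
  refine Finset.sum_congr rfl fun s _ => ?_
  have hlt := (x s).1.isLt
  have h : ((b - (x s).1)! : ZMod p) =
      ((b - I)! : ZMod p) *
        (ascPochhammer (ZMod p) (I - (x s).1)).eval ((b - I + 1 : ℕ) : ZMod p) := by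
    rw [← ascPochhammer_eval_cast, ascPochhammer_nat_eq_ascFactorial, ← Nat.cast_mul,
      Nat.factorial_mul_ascFactorial]
    congr 2
    omega
  rw [factorialMul, h, Polynomial.eval_C_mul]
  ring

/-- A nonzero polynomial of degree at most `I` vanishes for at most `I` values of `b`. -/
lemma card_shiftPoly_roots_le {ℓ I K M : ℕ} (hI : 1 ≤ I) (hp : K + M < p) (g : β → ZMod p)
    (x : Fin (2 * ℓ) → Fin I × β) (h : shiftPoly g x ≠ 0) :
    ((Finset.Icc (K + I) (K + M)).filter fun b =>
      (shiftPoly g x).eval ((b - I + 1 : ℕ) : ZMod p) = 0).card ≤ I := by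
  refine le_trans ?_ (((shiftPoly g x).card_roots').trans (natDegree_shiftPoly_le g x))
  refine le_trans ?_ (Multiset.toFinset_card_le _)
  refine Finset.card_le_card_of_injOn (fun b => ((b - I + 1 : ℕ) : ZMod p)) ?_ ?_
  · intro b hb
    rw [Finset.mem_coe, Finset.mem_filter] at hb
    rw [Finset.mem_coe, Multiset.mem_toFinset, Polynomial.mem_roots h]
    exact hb.2
  · intro b hb c hc hbc
    rw [Finset.mem_coe, Finset.mem_filter, Finset.mem_Icc] at hb hc
    have := congrArg ZMod.val hbc
    simp only at this
    rw [ZMod.val_cast_of_lt (by omega), ZMod.val_cast_of_lt (by omega)] at this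
    omega

variable [Fintype β]

/-- The pairs `(j, w)` for which `b - j` lies in `[K + 1, K + M]`. -/
def shiftSet (β : Type*) [Fintype β] (K M I b : ℕ) : Finset (Fin I × β) :=
  Finset.univ.filter fun x => K + 1 + x.1 ≤ b ∧ b ≤ K + M + x.1

/-- Every `m` has exactly `I` representations `m = b - j` with `0 ≤ j < I`. -/
lemma mul_expSum_factorialMul (K M I : ℕ) (g : β → ZMod p) (a : ZMod p) :
    (I : ℂ) * expSum (Finset.Icc (K + 1) (K + M) ×ˢ Finset.univ) (factorialMul g) a =
      ∑ b ∈ Finset.Icc (K + 1) (K + M + I),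
        expSum (shiftSet β K M I b) (fun x => factorialMul g (b - x.1, x.2)) a := by
  unfold expSum shiftSet
  simp_rw [Finset.sum_filter]
  rw [Finset.sum_comm, Fintype.sum_prod_type]
  have h : ∀ j : Fin I, (∑ w : β, ∑ b ∈ Finset.Icc (K + 1) (K + M + I),
      if K + 1 + j ≤ b ∧ b ≤ K + M + j then
        (ZMod.stdAddChar (a * factorialMul g (b - j, w)) : ℂ) else 0) =
      ∑ x ∈ Finset.Icc (K + 1) (K + M) ×ˢ Finset.univ,
        ZMod.stdAddChar (a * factorialMul g x) := by
    intro j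
    have hj := j.isLt
    rw [Finset.sum_product_right]
    refine Finset.sum_congr rfl fun w _ => ?_
    rw [← Finset.sum_filter]
    refine Finset.sum_nbij' (fun b => b - j) (fun m => m + j) ?_ ?_ ?_ ?_ ?_
    · intro b hb
      rw [Finset.mem_filter] at hb
      rw [Finset.mem_Icc]
      omega
    · intro m hm
      rw [Finset.mem_Icc] at hm
      rw [Finset.mem_filter, Finset.mem_Icc]
      omega
    · intro b hb
      rw [Finset.mem_filter] at hb
      omega
    · intro m _
      simp
    · intro b _
      rfl
  rw [Finset.sum_congr rfl fun j _ => h j, Finset.sum_const, Finset.card_univ, Fintype.card_fin,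
    nsmul_eq_mul]

/-- The number of solutions with all arguments in one window `b - I < b - j ≤ b`. -/
def windowCount (ℓ K M I : ℕ) (g : β → ZMod p) (b : ℕ) : ℕ :=
  ((Fintype.piFinset fun _ : Fin (2 * ℓ) => shiftSet β K M I b).filter fun x =>
    ∑ s, sideSign p ℓ s * factorialMul g (b - (x s).1, (x s).2) = 0).card

lemma windowCount_le (ℓ K M I : ℕ) (g : β → ZMod p) (b : ℕ) :
    windowCount ℓ K M I g b ≤ (I * Fintype.card β) ^ (2 * ℓ) := by
  refine (Finset.card_le_univ _).trans (le_of_eq ?_)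
  simp

lemma sum_windowCount_interior_le (ℓ : ℕ) {K M I : ℕ} (hI : 1 ≤ I) (hp : K + M < p)
    (g : β → ZMod p) :
    ∑ b ∈ Finset.Icc (K + I) (K + M), windowCount ℓ K M I g b ≤
      (I * Fintype.card β) ^ (2 * ℓ) * I + M * degenerateCount ℓ I g := by
  have h1 : ∀ b ∈ Finset.Icc (K + I) (K + M), windowCount ℓ K M I g b ≤
      ∑ x : Fin (2 * ℓ) → Fin I × β,
        if (shiftPoly g x).eval ((b - I + 1 : ℕ) : ZMod p) = 0 then 1 else 0 := by
    intro b hb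
    rw [Finset.mem_Icc] at hb
    rw [← Finset.card_filter]
    refine Finset.card_le_card fun x hx => ?_
    have h := (Finset.mem_filter.1 hx).2
    rw [sum_factorialMul_eq_eval g x (by omega)] at h
    refine Finset.mem_filter.2 ⟨Finset.mem_univ _, (mul_eq_zero.1 h).resolve_left ?_⟩
    rw [ZMod.natCast_eq_zero_iff, (Fact.out : p.Prime).dvd_factorial]
    omega
  refine (Finset.sum_le_sum h1).trans ?_
  rw [Finset.sum_comm]
  have h2 : ∀ x : Fin (2 * ℓ) → Fin I × β, (∑ b ∈ Finset.Icc (K + I) (K + M),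
      if (shiftPoly g x).eval ((b - I + 1 : ℕ) : ZMod p) = 0 then 1 else 0) ≤
      I + M * if ∀ v, ∑ s with (x s).1 = v, sideSign p ℓ s * g (x s).2 = 0 then 1 else 0 := by
    intro x
    rw [← Finset.card_filter]
    by_cases h : shiftPoly g x = 0
    · rw [if_pos (sum_eq_zero_of_shiftPoly_eq_zero g x h)]
      refine (Finset.card_filter_le _ _).trans ?_
      rw [Nat.card_Icc]
      omega
    · exact (card_shiftPoly_roots_le hI hp g x h).trans (Nat.le_add_right _ _)
  refine (Finset.sum_le_sum fun x _ => h2 x).trans (le_of_eq ?_)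
  rw [Finset.sum_add_distrib, ← Finset.mul_sum, degenerateCount, Finset.card_filter,
    Finset.sum_const, Finset.card_univ]
  simp

/-- The at most `2 I` windows that meet the ends of the interval are counted trivially. -/
lemma sum_windowCount_le (ℓ : ℕ) {K M I : ℕ} (hI : 1 ≤ I) (hp : K + M < p) (g : β → ZMod p) :
    ∑ b ∈ Finset.Icc (K + 1) (K + M + I), windowCount ℓ K M I g b ≤
      3 * I * (I * Fintype.card β) ^ (2 * ℓ) + M * degenerateCount ℓ I g := by
  have hsub : Finset.Icc (K + I) (K + M) ⊆ Finset.Icc (K + 1) (K + M + I) :=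
    Finset.Icc_subset_Icc (by omega) (by omega)
  rw [← Finset.sum_sdiff hsub]
  have h1 := Finset.sum_le_card_nsmul (Finset.Icc (K + 1) (K + M + I) \ Finset.Icc (K + I) (K + M))
    (windowCount ℓ K M I g) _ fun b _ => windowCount_le ℓ K M I g b
  rw [Finset.card_sdiff_of_subset hsub, Nat.card_Icc, Nat.card_Icc, smul_eq_mul] at h1
  have h2 := Nat.mul_le_mul_right ((I * Fintype.card β) ^ (2 * ℓ))
    (show K + M + I + 1 - (K + 1) - (K + M + 1 - (K + I)) ≤ 2 * I by omega)
  have h3 := sum_windowCount_interior_le ℓ hI hp g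
  nlinarith

/-- Averaging over shifts bounds a moment over an interval of length `M` by the degenerate count
for shifts of length `I`. -/
lemma moment_factorialMul_le {ℓ : ℕ} (hℓ : 1 ≤ ℓ) {K M I : ℕ} (hI : 1 ≤ I) (hp : K + M < p)
    (g : β → ZMod p) :
    (I : ℝ) ^ (2 * ℓ) * ∑ a : ZMod p,
      ‖expSum (Finset.Icc (K + 1) (K + M) ×ˢ Finset.univ) (factorialMul g) a‖ ^ (2 * ℓ) ≤
      ((M : ℝ) + I) ^ (2 * ℓ - 1) *
        (3 * I * (I * Fintype.card β) ^ (2 * ℓ) + M * degenerateCount ℓ I g) * p := by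
  have hcard : (Finset.Icc (K + 1) (K + M + I)).card = M + I := by
    rw [Nat.card_Icc]; omega
  have h1 : ∀ a : ZMod p, (I : ℝ) ^ (2 * ℓ) *
      ‖expSum (Finset.Icc (K + 1) (K + M) ×ˢ Finset.univ) (factorialMul g) a‖ ^ (2 * ℓ) ≤
      ((M : ℝ) + I) ^ (2 * ℓ - 1) * ∑ b ∈ Finset.Icc (K + 1) (K + M + I),
        ‖expSum (shiftSet β K M I b) (fun x => factorialMul g (b - x.1, x.2)) a‖ ^ (2 * ℓ) := by
    intro a
    have h := pow_sum_div_card_le_sum_pow (s := Finset.Icc (K + 1) (K + M + I))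
      (f := fun b => ‖expSum (shiftSet β K M I b)
        (fun x => factorialMul g (b - x.1, x.2)) a‖) (fun _ _ => norm_nonneg _) (2 * ℓ - 1)
    rw [hcard, Nat.sub_add_cancel (by omega : 1 ≤ 2 * ℓ), div_le_iff₀ (by positivity)] at h
    push_cast at h
    rw [← mul_pow, mul_comm (((M : ℝ) + I) ^ (2 * ℓ - 1))]
    refine le_trans ?_ h
    have h' := congrArg norm (mul_expSum_factorialMul K M I g a)
    rw [norm_mul, Complex.norm_natCast] at h'
    rw [h']
    gcongr
    exact norm_sum_le _ _
  rw [Finset.mul_sum]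
  refine (Finset.sum_le_sum fun a _ => h1 a).trans ?_
  rw [← Finset.mul_sum, mul_assoc, Finset.sum_comm]
  refine mul_le_mul_of_nonneg_left ?_ (by positivity)
  have h2 : ∀ b ∈ Finset.Icc (K + 1) (K + M + I), (∑ a : ZMod p,
      ‖expSum (shiftSet β K M I b) (fun x => factorialMul g (b - x.1, x.2)) a‖ ^ (2 * ℓ)) =
      (windowCount ℓ K M I g b : ℝ) * p := fun b _ => by
    rw [windowCount, ← card_balanced_mul]
  rw [Finset.sum_congr rfl h2, ← Finset.sum_mul]
  refine mul_le_mul_of_nonneg_right ?_ (Nat.cast_nonneg p)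
  exact_mod_cast sum_windowCount_le ℓ hI hp g

end

/-! ### Moments of sums with one factorial -/

/-- The even moments of `∑ e(a m! / p)` over an interval of length `M`, saving
`M ^ (1 - 1 / (ℓ + 1))` over the trivial bound. Shifts of length about `M ^ (1 / (ℓ + 1))` balance
the two contributions. -/
theorem exists_moment_factorial_le {ℓ : ℕ} (hℓ : 1 ≤ ℓ) :
    ∃ C : ℝ, 1 ≤ C ∧ ∀ (p : ℕ) [Fact p.Prime] (K M : ℕ), 1 ≤ M → K + M < p →
      ∑ a : ZMod p, ‖expSum (Finset.Icc (K + 1) (K + M)) (fun m => (m ! : ZMod p)) a‖ ^ (2 * ℓ) ≤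
        C * (M : ℝ) ^ (2 * ℓ - 1) * (M : ℝ) ^ (((ℓ + 1 : ℕ) : ℝ)⁻¹) * p := by
  set c : ℝ := (ℓ : ℝ) ^ (2 * ℓ) * (ℓ + 1) with hc
  have hc0 : 0 ≤ c := by positivity
  refine ⟨2 ^ (2 * ℓ - 1) * (3 + c * 2 ^ (ℓ + 1)), ?_, ?_⟩
  · have h1 : (1 : ℝ) ≤ 2 ^ (2 * ℓ - 1) := one_le_pow₀ (by norm_num)
    have h2 : (1 : ℝ) ≤ 3 + c * 2 ^ (ℓ + 1) := by
      have : 0 ≤ c * 2 ^ (ℓ + 1) := by positivity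
      linarith
    exact one_le_mul_of_one_le_of_one_le h1 h2
  intro p _ K M hM hp
  have hp0 : (0 : ℝ) < p := by exact_mod_cast (Fact.out : p.Prime).pos
  set y : ℝ := (M : ℝ) ^ (((ℓ + 1 : ℕ) : ℝ)⁻¹) with hy
  have hM1 : (1 : ℝ) ≤ M := by exact_mod_cast hM
  have hy1 : 1 ≤ y := Real.one_le_rpow hM1 (by positivity)
  have hyM : y ^ (ℓ + 1) = M := Real.rpow_inv_natCast_pow (by positivity) (by omega)
  set I : ℕ := ⌊y⌋₊
  have hI : 1 ≤ I := Nat.one_le_floor_iff _ |>.2 hy1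
  have hI1 : (1 : ℝ) ≤ I := by exact_mod_cast hI
  have hIy : (I : ℝ) ≤ y := Nat.floor_le (by linarith)
  have hyI : y ≤ 2 * I := by linarith [Nat.lt_floor_add_one y]
  have hIM : (I : ℝ) ≤ M := hIy.trans (hyM ▸ le_self_pow₀ hy1 (by omega))
  set g : Unit → ZMod p := fun _ => 1 with hg
  have hexp : ∀ a : ZMod p, expSum (Finset.Icc (K + 1) (K + M) ×ˢ Finset.univ) (factorialMul g) a =
      expSum (Finset.Icc (K + 1) (K + M)) (fun m => (m ! : ZMod p)) a := by
    intro a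
    simp [expSum, factorialMul, hg]
  have htriv : ∀ (a : ZMod p) (k : ℕ), ‖expSum Finset.univ g a‖ ^ k ≤ 1 := by
    intro a k
    refine pow_le_one₀ (norm_nonneg _) ((norm_expSum_le _ g a).trans ?_)
    simp
  have htriv' : ∀ k : ℕ, ∑ a : ZMod p, ‖expSum Finset.univ g a‖ ^ k ≤ p := by
    intro k
    refine (Finset.sum_le_sum fun a _ => htriv a k).trans ?_
    simp [ZMod.card]
  have hD : (degenerateCount ℓ I g : ℝ) ≤ c * (I : ℝ) ^ ℓ := by
    have h := degenerateCount_mul_le hℓ I (g := g) (by simp [hg]) (θ := 1) zero_le_one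
      (by simpa using htriv' 2)
    have hS : ∑ r ∈ Finset.Icc 2 ℓ, ((I : ℝ) * 1) ^ r ≤ ℓ * (I : ℝ) ^ ℓ := by
      refine (Finset.sum_le_card_nsmul _ _ ((I : ℝ) ^ ℓ) fun r hr => ?_).trans ?_
      · rw [mul_one]
        exact pow_le_pow_right₀ hI1 (Finset.mem_Icc.1 hr).2
      · rw [Nat.card_Icc, nsmul_eq_mul]
        gcongr
        omega
    refine le_of_mul_le_mul_right (h.trans ?_) hp0
    simp only [Fintype.card_unit, Nat.cast_one, one_pow, one_mul]
    have h3 : (I : ℝ) * ∑ a : ZMod p, ‖expSum Finset.univ g a‖ ^ (2 * ℓ) ≤ (I : ℝ) ^ ℓ * p := by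
      gcongr
      · exact le_self_pow₀ hI1 (by omega)
      · exact htriv' _
    calc _ ≤ (ℓ : ℝ) ^ (2 * ℓ) * ((I : ℝ) ^ ℓ * p + p * (ℓ * (I : ℝ) ^ ℓ)) := by gcongr
      _ = _ := by rw [hc]; ring
  have hmain := moment_factorialMul_le hℓ hI hp g
  simp_rw [hexp] at hmain
  have hIpos : (0 : ℝ) < (I : ℝ) ^ (2 * ℓ) := by positivity
  refine le_of_mul_le_mul_left (hmain.trans ?_) hIpos
  have hMI : (M : ℝ) ≤ 2 ^ (ℓ + 1) * (I : ℝ) ^ (ℓ + 1) := by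
    rw [← mul_pow, ← hyM]
    gcongr
  simp only [Fintype.card_unit, Nat.cast_one, mul_one]
  calc _ ≤ (2 * (M : ℝ)) ^ (2 * ℓ - 1) * (3 * I * (I : ℝ) ^ (2 * ℓ) +
        2 ^ (ℓ + 1) * (I : ℝ) ^ (ℓ + 1) * (c * (I : ℝ) ^ ℓ)) * p := by
        gcongr
        linarith
    _ = (I : ℝ) ^ (2 * ℓ) * (2 ^ (2 * ℓ - 1) * (3 + c * 2 ^ (ℓ + 1)) *
        (M : ℝ) ^ (2 * ℓ - 1) * I * p) := by
        rw [mul_pow]; ring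
    _ ≤ _ := by gcongr

/-! ### Moments of sums with two factorials -/

/-- The smallest number of distinct shifts dominates; used with `x = I / √N`. -/
lemma sum_Icc_two_pow_le {ℓ : ℕ} {C x : ℝ} (hC : 1 ≤ C) (hx0 : 0 ≤ x) (hx : x ≤ 1) :
    ∑ r ∈ Finset.Icc 2 ℓ, (C * x) ^ r ≤ ℓ * C ^ ℓ * x ^ 2 := by
  refine (Finset.sum_le_card_nsmul _ _ (C ^ ℓ * x ^ 2) fun r hr => ?_).trans ?_
  · have hr' := Finset.mem_Icc.1 hr
    rw [mul_pow]
    exact mul_le_mul (pow_le_pow_right₀ hC hr'.2)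
      (pow_le_pow_of_le_one hx0 hx hr'.1) (by positivity) (by positivity)
  · rw [Nat.card_Icc, nsmul_eq_mul, mul_assoc]
    gcongr
    omega

/-- The even moments of `∑ e(a m! n! / p)`, for `N ≤ M ≤ N²`. -/
theorem exists_moment_factorial_mul_factorial_le {ℓ : ℕ} (hℓ : 1 ≤ ℓ) :
    ∃ C : ℝ, 0 < C ∧ ∀ (p : ℕ) [Fact p.Prime] (K M L N : ℕ), 1 ≤ N → N ≤ M → M ≤ N ^ 2 →
      K + M < p → L + N < p →
      ∑ a : ZMod p, ‖expSum (Finset.Icc (K + 1) (K + M) ×ˢ Finset.Icc (L + 1) (L + N))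
        (fun x => (x.1 ! * x.2 ! : ZMod p)) a‖ ^ (2 * ℓ) ≤
        C * (M : ℝ) ^ (2 * ℓ - 1) * (N : ℝ) ^ (2 * ℓ) *
          ((M : ℝ) / ((N : ℝ) ^ (((ℓ + 1 : ℕ) : ℝ)⁻¹)) ^ ℓ) ^ (((2 * ℓ : ℕ) : ℝ)⁻¹) * p := by
  obtain ⟨C₁, hC₁, hJ⟩ := exists_moment_factorial_le hℓ
  obtain ⟨C₂, hC₂, hJ₂⟩ := exists_moment_factorial_le le_rfl
  set c : ℝ := (ℓ : ℝ) ^ (2 * ℓ) * (4 ^ ℓ * (C₁ + ℓ * C₂ ^ ℓ)) with hc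
  have hc0 : 0 ≤ c := by positivity
  refine ⟨2 ^ (2 * ℓ - 1) * (3 + c), by positivity, ?_⟩
  intro p _ K M L N hN hNM hMN hp hp'
  have hp0 : (0 : ℝ) < p := by exact_mod_cast (Fact.out : p.Prime).pos
  have hN1 : (1 : ℝ) ≤ N := by exact_mod_cast hN
  have hN0 : (0 : ℝ) < N := by linarith
  have hNM' : (N : ℝ) ≤ M := by exact_mod_cast hNM
  have hMN' : (M : ℝ) ≤ (N : ℝ) ^ 2 := by exact_mod_cast hMN
  set y : ℝ := (N : ℝ) ^ (((ℓ + 1 : ℕ) : ℝ)⁻¹) with hy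
  have hy1 : 1 ≤ y := Real.one_le_rpow hN1 (by positivity)
  have hyN : y ^ (ℓ + 1) = N := Real.rpow_inv_natCast_pow (by positivity) (by omega)
  have hy0 : 0 < y := by linarith
  set z : ℝ := ((M : ℝ) / y ^ ℓ) ^ (((2 * ℓ : ℕ) : ℝ)⁻¹) with hz
  have hyM : y ^ ℓ ≤ M := by
    refine le_trans ?_ hNM'
    rw [← hyN]
    exact pow_le_pow_right₀ hy1 (by omega)
  have hz1 : 1 ≤ z := Real.one_le_rpow ((one_le_div (by positivity)).2 hyM) (by positivity)
  have hzM : z ^ (2 * ℓ) * y ^ ℓ = M := by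
    rw [hz, Real.rpow_inv_natCast_pow (by positivity) (by omega)]
    field_simp
  set I : ℕ := ⌊z⌋₊
  have hI : 1 ≤ I := Nat.one_le_floor_iff _ |>.2 hz1
  have hI1 : (1 : ℝ) ≤ I := by exact_mod_cast hI
  have hIz : (I : ℝ) ≤ z := Nat.floor_le (by linarith)
  have hzI : z ≤ 2 * I := by linarith [Nat.lt_floor_add_one z]
  have hIM : (I : ℝ) ≤ M := by
    refine hIz.trans ((le_self_pow₀ hz1 (by omega : 2 * ℓ ≠ 0)).trans ?_)
    rw [← hzM]
    exact le_mul_of_one_le_right (by positivity) (one_le_pow₀ hy1)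
  have hMI : (M : ℝ) ≤ 4 ^ ℓ * (I : ℝ) ^ (2 * ℓ) * y ^ ℓ := by
    rw [← hzM]
    have : z ^ (2 * ℓ) ≤ (2 * I) ^ (2 * ℓ) := by gcongr
    rw [mul_pow, pow_mul 2] at this
    norm_num at this
    gcongr
  -- This is where `M ≤ N²` enters: `z ^ (2ℓ) = M / y ^ ℓ ≤ y ^ (ℓ + 2) ≤ y ^ (2ℓ)`.
  have hIy : 2 ≤ ℓ → (I : ℝ) ≤ y := by
    intro h2
    refine hIz.trans (le_of_pow_le_pow_left₀ (by omega : 2 * ℓ ≠ 0) hy0.le ?_)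
    refine le_of_mul_le_mul_right ?_ (pow_pos hy0 ℓ)
    rw [hzM, ← pow_add]
    refine hMN'.trans ?_
    rw [← hyN, ← pow_mul]
    exact pow_le_pow_right₀ hy1 (by omega)
  set g : ↥(Finset.Icc (L + 1) (L + N)) → ZMod p := fun n => (n.1 ! : ZMod p) with hg
  have hg0 : ∀ w, g w ≠ 0 := by
    rintro ⟨n, hn⟩
    rw [Finset.mem_Icc] at hn
    simp only [hg]
    rw [Ne, ZMod.natCast_eq_zero_iff, (Fact.out : p.Prime).dvd_factorial]
    omega
  have hcardW : Fintype.card ↥(Finset.Icc (L + 1) (L + N)) = N := by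
    rw [Fintype.card_coe, Nat.card_Icc]; omega
  have hexp : ∀ a : ZMod p, expSum (Finset.Icc (K + 1) (K + M) ×ˢ Finset.univ) (factorialMul g) a =
      expSum (Finset.Icc (K + 1) (K + M) ×ˢ Finset.Icc (L + 1) (L + N))
        (fun x => (x.1 ! * x.2 ! : ZMod p)) a := by
    intro a
    unfold expSum factorialMul
    rw [Finset.sum_product, Finset.sum_product]
    refine Finset.sum_congr rfl fun m _ => ?_
    exact Finset.sum_coe_sort (Finset.Icc (L + 1) (L + N))
      (fun n => (ZMod.stdAddChar (a * (m ! * n ! : ZMod p)) : ℂ))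
  have hexp' : ∀ a : ZMod p, expSum Finset.univ g a =
      expSum (Finset.Icc (L + 1) (L + N)) (fun n => (n ! : ZMod p)) a := by
    intro a
    exact Finset.sum_coe_sort (Finset.Icc (L + 1) (L + N))
      (fun n => (ZMod.stdAddChar (a * (n ! : ZMod p)) : ℂ))
  have hsq : √(N : ℝ) ^ 2 = N := Real.sq_sqrt hN0.le
  have hs0 : 0 < √(N : ℝ) := Real.sqrt_pos.2 hN0
  set S : ℝ := ∑ r ∈ Finset.Icc 2 ℓ, ((I : ℝ) * (C₂ / √N)) ^ r with hSdef
  have hS : y ^ ℓ * S ≤ ℓ * C₂ ^ ℓ * I := by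
    -- For `ℓ = 1` the bound `I ≤ y` may fail, but then the sum is empty.
    rcases (by omega : ℓ < 2 ∨ 2 ≤ ℓ) with h2 | h2
    · rw [hSdef, Finset.Icc_eq_empty (by omega), Finset.sum_empty, mul_zero]
      positivity
    have hx : (I : ℝ) / √N ≤ 1 := by
      rw [div_le_one hs0]
      refine (hIy h2).trans (Real.le_sqrt_of_sq_le ?_)
      rw [← hyN]
      exact pow_le_pow_right₀ hy1 (by omega)
    have h := sum_Icc_two_pow_le (ℓ := ℓ) hC₂ (by positivity) hx
    rw [div_pow, hsq] at h
    have hSx : S ≤ ℓ * C₂ ^ ℓ * ((I : ℝ) ^ 2 / N) := by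
      refine le_trans (le_of_eq (Finset.sum_congr rfl fun r _ => ?_)) h
      congr 1; ring
    calc y ^ ℓ * S ≤ y ^ ℓ * (ℓ * C₂ ^ ℓ * ((I : ℝ) ^ 2 / N)) := by gcongr
      _ = ℓ * C₂ ^ ℓ * (I * (I / y)) := by rw [← hyN]; field_simp; ring
      _ ≤ ℓ * C₂ ^ ℓ * (I * 1) := by
        gcongr
        exact (div_le_one hy0).2 (hIy h2)
      _ = _ := by rw [mul_one]
  have hMD : (M : ℝ) * degenerateCount ℓ I g ≤ c * (I * (I * N : ℝ) ^ (2 * ℓ)) := by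
    have h := degenerateCount_mul_le hℓ I hg0 (θ := C₂ / √N) (by positivity) (by
      simp_rw [hexp']
      have := hJ₂ p L N hN hp'
      refine this.trans (le_of_eq ?_)
      rw [hcardW]
      have h2 : (N : ℝ) ^ (((1 + 1 : ℕ) : ℝ)⁻¹) = √N := by
        rw [Real.sqrt_eq_rpow]; norm_num
      rw [h2]
      field_simp
      rw [hsq]
      norm_num
      ring)
    simp_rw [hexp', hcardW] at h
    have hD : (degenerateCount ℓ I g : ℝ) ≤ (ℓ : ℝ) ^ (2 * ℓ) *
        (I * (C₁ * (N : ℝ) ^ (2 * ℓ - 1) * y) +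
          (N : ℝ) ^ (2 * ℓ) * S) := by
      refine le_of_mul_le_mul_right (h.trans ?_) hp0
      calc _ ≤ (ℓ : ℝ) ^ (2 * ℓ) * (I * (C₁ * (N : ℝ) ^ (2 * ℓ - 1) * y * p) +
          (N : ℝ) ^ (2 * ℓ) * p * S) := by
            gcongr
            exact hJ p L N hN hp'
        _ = _ := by ring
    have hS0 : 0 ≤ S := Finset.sum_nonneg fun r _ => by positivity
    have hN' : (N : ℝ) ^ (2 * ℓ) = (N : ℝ) ^ (2 * ℓ - 1) * N := by
      rw [← pow_succ]; congr 1; omega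
    have h1 : (M : ℝ) * (I * (C₁ * (N : ℝ) ^ (2 * ℓ - 1) * y)) ≤
        4 ^ ℓ * C₁ * (I * (I * N : ℝ) ^ (2 * ℓ)) := by
      calc _ ≤ 4 ^ ℓ * (I : ℝ) ^ (2 * ℓ) * y ^ ℓ * (I * (C₁ * (N : ℝ) ^ (2 * ℓ - 1) * y)) := by
            gcongr
        _ = 4 ^ ℓ * C₁ * (I * ((I : ℝ) ^ (2 * ℓ) * ((N : ℝ) ^ (2 * ℓ - 1) * y ^ (ℓ + 1)))) := by
            ring
        _ = _ := by rw [hyN, ← hN', mul_pow]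
    have h2 : (M : ℝ) * ((N : ℝ) ^ (2 * ℓ) * S) ≤
        4 ^ ℓ * (ℓ * C₂ ^ ℓ) * (I * (I * N : ℝ) ^ (2 * ℓ)) := by
      calc _ ≤ 4 ^ ℓ * (I : ℝ) ^ (2 * ℓ) * y ^ ℓ * ((N : ℝ) ^ (2 * ℓ) * S) := by gcongr
        _ = 4 ^ ℓ * (I * N : ℝ) ^ (2 * ℓ) * (y ^ ℓ * S) := by rw [mul_pow]; ring
        _ ≤ 4 ^ ℓ * (I * N : ℝ) ^ (2 * ℓ) * (ℓ * C₂ ^ ℓ * I) := by gcongr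
        _ = _ := by ring
    calc _ ≤ (M : ℝ) * ((ℓ : ℝ) ^ (2 * ℓ) *
        (I * (C₁ * (N : ℝ) ^ (2 * ℓ - 1) * y) +
          (N : ℝ) ^ (2 * ℓ) * S)) := by gcongr
      _ = (ℓ : ℝ) ^ (2 * ℓ) * ((M : ℝ) * (I * (C₁ * (N : ℝ) ^ (2 * ℓ - 1) * y)) +
          (M : ℝ) * ((N : ℝ) ^ (2 * ℓ) * S)) := by ring
      _ ≤ (ℓ : ℝ) ^ (2 * ℓ) * (4 ^ ℓ * C₁ * (I * (I * N : ℝ) ^ (2 * ℓ)) +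
          4 ^ ℓ * (ℓ * C₂ ^ ℓ) * (I * (I * N : ℝ) ^ (2 * ℓ))) := by gcongr
      _ = _ := by rw [hc]; ring
  have hmain := moment_factorialMul_le hℓ hI hp g
  simp_rw [hexp, hcardW] at hmain
  have hIpos : (0 : ℝ) < (I : ℝ) ^ (2 * ℓ) := by positivity
  refine le_of_mul_le_mul_left (hmain.trans ?_) hIpos
  calc _ ≤ (2 * (M : ℝ)) ^ (2 * ℓ - 1) * (3 * I * (I * N : ℝ) ^ (2 * ℓ) +
        c * (I * (I * N : ℝ) ^ (2 * ℓ))) * p := by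
        gcongr
        linarith
    _ = (I : ℝ) ^ (2 * ℓ) * (2 ^ (2 * ℓ - 1) * (3 + c) *
        (M : ℝ) ^ (2 * ℓ - 1) * (N : ℝ) ^ (2 * ℓ) * I * p) := by
        rw [mul_pow, mul_pow]; ring
    _ ≤ _ := by gcongr

/-! ### The number of solutions -/

lemma doubleFactorialCount_mul_le (p ℓ K M L N : ℕ) [Fact p.Prime] :
    (doubleFactorialCount p ℓ K M L N : ℝ) * p ≤
      ∑ a : ZMod p, ‖expSum (Finset.Icc (K + 1) (K + M) ×ˢ Finset.Icc (L + 1) (L + N))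
        (fun x => (x.1 ! * x.2 ! : ZMod p)) a‖ ^ (2 * ℓ) := by
  rw [← card_balanced_mul, doubleFactorialCount]
  refine mul_le_mul_of_nonneg_right ?_ (Nat.cast_nonneg p)
  refine Nat.cast_le.2 (Finset.card_le_card_of_injOn (fun x s => (x.1 s, x.2 s)) ?_ ?_)
  · intro x hx
    rw [Finset.mem_coe, doubleFactorialSolutions, Finset.mem_filter, Finset.mem_product,
      Fintype.mem_piFinset, Fintype.mem_piFinset] at hx
    obtain ⟨⟨h1, h2⟩, h3⟩ := hx
    rw [Finset.mem_coe, Finset.mem_filter, Fintype.mem_piFinset]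
    refine ⟨fun s => Finset.mem_product.2 ⟨h1 s, h2 s⟩, ?_⟩
    have h4 := (ZMod.natCast_eq_natCast_iff _ _ p).2 h3
    push_cast at h4
    rw [← Finset.sum_filter_add_sum_filter_not Finset.univ (fun s : Fin (2 * ℓ) => s.val < ℓ)]
    have e1 : ∑ s : Fin (2 * ℓ) with s.val < ℓ,
        sideSign p ℓ s * ((x.1 s)! * (x.2 s)! : ZMod p) =
        ∑ s : Fin (2 * ℓ) with s.val < ℓ, ((x.2 s)! * (x.1 s)! : ZMod p) := by
      refine Finset.sum_congr rfl fun s hs => ?_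
      rw [sideSign, if_pos (Finset.mem_filter.1 hs).2]
      ring
    have e2 : ∑ s : Fin (2 * ℓ) with ¬ s.val < ℓ,
        sideSign p ℓ s * ((x.1 s)! * (x.2 s)! : ZMod p) =
        -∑ s : Fin (2 * ℓ) with ℓ ≤ s.val, ((x.2 s)! * (x.1 s)! : ZMod p) := by
      simp_rw [← not_lt]
      rw [← Finset.sum_neg_distrib]
      refine Finset.sum_congr rfl fun s hs => ?_
      rw [sideSign, if_neg (Finset.mem_filter.1 hs).2]
      ring
    rw [e1, e2, h4]
    exact add_neg_cancel _
  · intro x _ y _ hxy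
    have h := fun s => congrFun hxy s
    simp only [Prod.mk.injEq] at h
    exact Prod.ext (funext fun s => (h s).1) (funext fun s => (h s).2)

lemma expSum_factorial_mul_comm {p : ℕ} [Fact p.Prime] (A B : Finset ℕ) (a : ZMod p) :
    expSum (A ×ˢ B) (fun x => (x.1 ! * x.2 ! : ZMod p)) a =
      expSum (B ×ˢ A) (fun x => (x.1 ! * x.2 ! : ZMod p)) a := by
  unfold expSum
  rw [Finset.sum_product, Finset.sum_product_right]
  simp_rw [mul_comm]

lemma rpow_exponents_eq {ℓ : ℕ} (hℓ : 1 ≤ ℓ) {M N : ℝ} (hM : 0 < M) (hN : 0 < N) :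
    M ^ (2 * ℓ - 1) * N ^ (2 * ℓ) *
        (M / (N ^ (((ℓ + 1 : ℕ) : ℝ)⁻¹)) ^ ℓ) ^ (((2 * ℓ : ℕ) : ℝ)⁻¹) =
      M ^ (2 * (ℓ : ℝ) - 1 + 1 / (2 * (ℓ : ℝ))) *
        N ^ (2 * (ℓ : ℝ) - 1 / (2 * ((ℓ : ℝ) + 1))) := by
  have hℓ0 : (ℓ : ℝ) ≠ 0 := by positivity
  rw [← Real.rpow_natCast M, ← Real.rpow_natCast N, ← Real.rpow_natCast (N ^ _),
    ← Real.rpow_mul hN.le, Real.div_rpow hM.le (by positivity), ← Real.rpow_mul hN.le,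
    Nat.cast_sub (by omega), Real.rpow_add hM, Real.rpow_sub hN]
  push_cast
  rw [one_div (2 * (ℓ : ℝ)), show ((ℓ : ℝ) + 1)⁻¹ * ℓ * (2 * (ℓ : ℝ))⁻¹ =
    1 / (2 * ((ℓ : ℝ) + 1)) by field_simp]
  ring

/-- For `M ≤ N` the bound with the roles of `M` and `N` exchanged is the stronger one. -/
lemma rpow_exponents_swap_le {ℓ : ℕ} (hℓ : 1 ≤ ℓ) {M N : ℝ} (hM : 0 < M) (hMN : M ≤ N) :
    N ^ (2 * (ℓ : ℝ) - 1 + 1 / (2 * (ℓ : ℝ))) * M ^ (2 * (ℓ : ℝ) - 1 / (2 * ((ℓ : ℝ) + 1))) ≤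
      M ^ (2 * (ℓ : ℝ) - 1 + 1 / (2 * (ℓ : ℝ))) *
        N ^ (2 * (ℓ : ℝ) - 1 / (2 * ((ℓ : ℝ) + 1))) := by
  have hN : 0 < N := hM.trans_le hMN
  have hℓ1 : (1 : ℝ) ≤ ℓ := by exact_mod_cast hℓ
  set u : ℝ := 2 * (ℓ : ℝ) - 1 + 1 / (2 * (ℓ : ℝ)) with hu
  set v : ℝ := 2 * (ℓ : ℝ) - 1 / (2 * ((ℓ : ℝ) + 1)) with hv
  have huv : 0 ≤ v - u := by
    have h1 : 1 / (2 * (ℓ : ℝ)) ≤ 1 / 2 := one_div_le_one_div_of_le (by norm_num) (by linarith)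
    have h2 : 1 / (2 * ((ℓ : ℝ) + 1)) ≤ 1 / 2 :=
      one_div_le_one_div_of_le (by norm_num) (by linarith)
    rw [hu, hv]
    linarith
  have hsplit : ∀ x : ℝ, 0 < x → x ^ v = x ^ u * x ^ (v - u) := fun x hx => by
    rw [← Real.rpow_add hx, add_sub_cancel]
  rw [hsplit M hM, hsplit N hN, mul_left_comm]
  have h := Real.rpow_le_rpow hM.le hMN huv
  exact mul_le_mul_of_nonneg_left (mul_le_mul_of_nonneg_left h (by positivity)) (by positivity)

theorem theorem3 (ℓ : ℕ) (hℓ : 1 ≤ ℓ) :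
    ∃ C : ℝ, 0 < C ∧
      ∀ p : ℕ, p.Prime → p ≠ 2 →
      ∀ K M L N : ℕ,
        K < K + M → K + M < p →
        L < L + N → L + N < p →
        (M : ℝ) ≤ (N : ℝ) ^ 2 → (N : ℝ) ^ (1 / 2 : ℝ) ≤ (M : ℝ) →
        (doubleFactorialCount p ℓ K M L N : ℝ) ≤
          C * (M : ℝ) ^ (2 * (ℓ : ℝ) - 1 + 1 / (2 * (ℓ : ℝ))) *
            (N : ℝ) ^ (2 * (ℓ : ℝ) - 1 / (2 * ((ℓ : ℝ) + 1))) := by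
  obtain ⟨C, hC, h⟩ := exists_moment_factorial_mul_factorial_le hℓ
  refine ⟨C, hC, ?_⟩
  intro p hprime _ K M L N hM hMp hN hNp hMN hNM
  have : Fact p.Prime := ⟨hprime⟩
  have hp0 : (0 : ℝ) < p := by exact_mod_cast hprime.pos
  have hM1 : 1 ≤ M := by omega
  have hN1 : 1 ≤ N := by omega
  have hM0 : (0 : ℝ) < M := by exact_mod_cast hM1
  have hN0 : (0 : ℝ) < N := by exact_mod_cast hN1
  rw [mul_assoc]
  refine le_of_mul_le_mul_right ((doubleFactorialCount_mul_le p ℓ K M L N).trans ?_) hp0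
  rcases le_total N M with hle | hle
  · have hb := h p K M L N hN1 hle (by exact_mod_cast hMN) hMp hNp
    rwa [mul_assoc C, mul_assoc C, rpow_exponents_eq hℓ hM0 hN0] at hb
  · have hNM2 : (N : ℝ) ≤ (M : ℝ) ^ 2 := by
      rw [← Real.sqrt_eq_rpow] at hNM
      exact (Real.sqrt_le_left hM0.le).1 hNM
    have hb := h p L N K M hM1 hle (by exact_mod_cast hNM2) hNp hMp
    rw [mul_assoc C, mul_assoc C, rpow_exponents_eq hℓ hN0 hM0] at hb
    simp_rw [expSum_factorial_mul_comm (Finset.Icc (L + 1) (L + N))] at hb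
    refine hb.trans ?_
    have hle' : (M : ℝ) ≤ N := by exact_mod_cast hle
    exact mul_le_mul_of_nonneg_right
      (mul_le_mul_of_nonneg_left (rpow_exponents_swap_le hℓ hM0 hle') hC.le) hp0.le
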